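/- **Theorem (non-concentration for random walks on abelian groups).** There is an absolute constant $C>0$ such that the following holds. Let $\Lambda$ be a finitely generated abelian group, written additively, let $\Lambda_2$ be its torsion subgroup, and fix a decomposition $\Lambda=\Lambda_1\oplus\Lambda_2$ (so that $\Lambda_1$ is free abelian of finite rank), with projection $\pi_2:\Lambda\to\Lambda_2$ along $\Lambda_1$. Let $0<\beta<\tfrac12$ and let $\nu$ be a finitely supported probability measure on $\Lambda$ such that 1. $\beta\le\nu(0)\le 1-\beta$; 2. $\nu$ is torsion-generating, that is, the support of the push-forward $(\pi_2)_*\nu$ generates the group $\Lambda_2$. For $n\ge 1$ let $\nu^{(n)}$ be the $n$-th convolution power of $\nu$. (a) If $r\ge 1$ is an integer such that the set $\Lambda^{\le r}$ of elements of $\Lambda$ of finite order at most $r$ satisfies $\nu(\Lambda^{\le r})\le 1-\beta$, then for all integers $n\ge 1$ $$\nu^{(n)}(0)\le\frac{1+e^{-n\beta/4}}{r}+\frac{2C}{\sqrt{n\beta}}.$$ (b) Without any assumption on $\nu(\Lambda^{\le r})$, for all integers $n\ge 1$ $$\nu^{(n)}(0)\le\frac{1+e^{-n\beta/4}}{2}+\frac{2C}{\sqrt{n\beta}}.$$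 -/

import Mathlib

namespace AbelianWalk

noncomputable section

variable {Λ : Type*} [AddCommGroup Λ]

/-- The convolution of two probability measures on an abelian group: the law of `a₁ + a₂`
for independent `a₁`, `a₂` with laws `μ₁`, `μ₂`. -/
def conv (μ₁ μ₂ : PMF Λ) : PMF Λ := μ₁.bind fun a₁ => μ₂.map fun a₂ => a₁ + a₂

/-- The explicit formula for the convolution. -/
theorem conv_apply (μ₁ μ₂ : PMF Λ) (a : Λ) :
    conv μ₁ μ₂ a = ∑' a₁, μ₁ a₁ * μ₂ (a - a₁) := by
  classical
  unfold conv
  rw [PMF.bind_apply]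
  refine tsum_congr fun a₁ => ?_
  rw [PMF.map_apply, tsum_eq_single (a - a₁)]
  · simp
  · intro b hb
    rw [if_neg]
    rintro rfl
    exact hb (by abel)

/-- The `n`-th convolution power `ν⁽ⁿ⁾`, with the point mass at `0` for `n = 0`. -/
def convPow (ν : PMF Λ) : ℕ → PMF Λ
  | 0 => PMF.pure 0
  | n + 1 => conv (convPow ν n) ν

/-- The real number `ν(B) = ∑_{a ∈ B} ν(a)`. -/
def mass (ν : PMF Λ) (B : Set Λ) : ℝ := (∑' a : B, ν a).toReal

/-- The set of elements of (finite) order at most `r`; Mathlib's `addOrderOf` is `0` on elements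
of infinite order, and these are excluded. -/
def orderAtMost (Λ : Type*) [AddCommGroup Λ] (r : ℕ) : Set Λ :=
  {a | 0 < addOrderOf a ∧ addOrderOf a ≤ r}

/-- The projection of `Λ = Λ₁ ⊕ Λ₂` onto the torsion subgroup `Λ₂`, along a complement `Λ₁`. -/
def torsionProj (Λ₁ : AddSubgroup Λ) (h : IsCompl Λ₁ (AddCommGroup.torsion Λ)) :
    Λ →+ AddCommGroup.torsion Λ :=
  (Submodule.projectionOnto (AddSubgroup.toIntSubmodule (AddCommGroup.torsion Λ))
    (AddSubgroup.toIntSubmodule Λ₁)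
    (AddSubgroup.toIntSubmodule.isCompl h.symm)).toAddMonoidHom

/-- The projection sends `x + y`, with `x ∈ Λ₁` and `y ∈ Λ₂`, to `y`. -/
theorem torsionProj_add (Λ₁ : AddSubgroup Λ) (h : IsCompl Λ₁ (AddCommGroup.torsion Λ))
    (x : Λ₁) (y : AddCommGroup.torsion Λ) : torsionProj Λ₁ h (x + y) = y := by
  have h' := AddSubgroup.toIntSubmodule.isCompl h.symm
  have hx := Submodule.projectionOnto_apply_right h' x
  have hy := Submodule.projectionOnto_apply_left h' y
  rw [map_add]
  exact (congrArg₂ (fun u v : AddCommGroup.torsion Λ => u + v) hx hy).trans (zero_add y)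

/-- `ν` is torsion-generating with respect to the decomposition `Λ = Λ₁ ⊕ Λ₂`, `Λ₂` the torsion
subgroup: the support of the push-forward of `ν` under the projection to `Λ₂` generates `Λ₂`. -/
def TorsionGenerating (ν : PMF Λ) (Λ₁ : AddSubgroup Λ)
    (h : IsCompl Λ₁ (AddCommGroup.torsion Λ)) : Prop :=
  AddSubgroup.closure (ν.map (torsionProj Λ₁ h)).support = ⊤

end

end AbelianWalk

namespace AbelianWalk

/-! ### The simple random walk on the half-line, killed at `0` -/

/-! The proof bounds the whole concentration function, the largest mass `ν⁽ⁿ⁾(A)` over sets of `k`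
elements, by `k / (r + 1)` plus the probability that a lazy simple walk on `ℕ`, started at `k` and
moving with probability `2β`, avoids `0` up to time `n`. In one step, mass `β` at `0` is paired with
mass `β` on elements `b` of order greater than `r`. If `1 ≤ |A| ≤ r`, then `A` is not invariant
under `b`, so `A` and `A - b` have a strictly larger union and a strictly smaller intersection. A
concave bound `g` then yields `g (k + 2) + g k` in place of `2 * g (k + 1)` (`sum_conv_le`), which
is the lazy step on `ℕ`. Survival is concave in `k` (`lazySurvival_concave`), so the induction
closes in `sum_convPow_le`. At `k = 1` it is at most `1 / √(np)` with `p = 2β`, by a central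
binomial estimate. -/

/-- The transition operator of the simple random walk on `ℕ` killed at `0`. -/
noncomputable def killedStep : Module.End ℝ (ℕ → ℝ) where
  toFun g
    | 0 => 0
    | k + 1 => (g (k + 2) + g k) / 2
  map_add' f g := by
    ext k; cases k
    · simp
    · simp only [Pi.add_apply]; ring
  map_smul' c g := by
    ext k; cases k
    · simp
    · simp only [Pi.smul_apply, smul_eq_mul, RingHom.id_apply]; ring

@[simp] theorem killedStep_zero (g : ℕ → ℝ) : killedStep g 0 = 0 := rfl

@[simp] theorem killedStep_succ (g : ℕ → ℝ) (k : ℕ) :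
    killedStep g (k + 1) = (g (k + 2) + g k) / 2 := rfl

/-- The probability that the simple random walk started at `k` has not hit `0` by time `j`. -/
noncomputable def survival (j k : ℕ) : ℝ :=
  ∑ i ∈ Finset.range k, (j.choose ((j + i + 1) / 2) : ℝ) / 2 ^ j

theorem survival_succ_right (j k : ℕ) :
    survival j (k + 1) = survival j k + (j.choose ((j + k + 1) / 2) : ℝ) / 2 ^ j :=
  Finset.sum_range_succ _ _

theorem survival_zero_right (j : ℕ) : survival j 0 = 0 := by simp [survival]

theorem survival_zero_succ (k : ℕ) : survival 0 (k + 1) = 1 := by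
  induction k with
  | zero => simp [survival]
  | succ k ih =>
    rw [survival_succ_right, ih]
    rw [Nat.choose_eq_zero_of_lt (by omega : 0 < (0 + (k + 1) + 1) / 2)]
    simp

/-- By reflection, survival from `k` is the probability that the free walk satisfies `-k < S_j ≤ k`,
which gives the binomial sum. The recursion is Pascal's rule applied to increments in `k`; at the
boundary it uses the symmetry of binomial coefficients. -/
theorem survival_succ_left (j : ℕ) : survival (j + 1) = killedStep (survival j) := by
  funext k
  cases k with
  | zero => simp [survival_zero_right]
  | succ k =>
    rw [killedStep_succ]
    induction k with
    | zero =>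
      rw [survival_succ_right, survival_succ_right j 1, survival_succ_right j 0,
        survival_zero_right, survival_zero_right]
      have h1 : (j + 1 + 0 + 1) / 2 = j / 2 + 1 := by omega
      have h3 : j.choose ((j + 0 + 1) / 2) = j.choose (j / 2) :=
        Nat.choose_symm_of_eq_add (by omega)
      rw [h1, h3, Nat.choose_succ_succ]
      push_cast
      field_simp
      ring
    | succ k ih =>
      rw [survival_succ_right (j + 1), ih, survival_succ_right j (k + 2), survival_succ_right j k]
      have h1 : (j + 1 + (k + 1) + 1) / 2 = (j + k + 1) / 2 + 1 := by omega
      have h2 : (j + (k + 2) + 1) / 2 = (j + k + 1) / 2 + 1 := by omega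
      rw [h1, h2, Nat.choose_succ_succ]
      push_cast
      field_simp
      ring

theorem killedStep_pow_survival (j : ℕ) :
    (killedStep ^ j) (survival 0) = survival j := by
  induction j with
  | zero => simp
  | succ j ih => rw [pow_succ', Module.End.mul_apply, ih, survival_succ_left]

/-- The ratio of the two sides is monotone in `m`, because `(2m + 1)(2m + 3) ≤ 4(m + 1)²`. -/
theorem centralBinom_sq_mul_le (m : ℕ) :
    ((m.centralBinom : ℝ)) ^ 2 * (2 * m + 1) ≤ (4 ^ m) ^ 2 := by
  induction m with
  | zero => simp
  | succ m ih =>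
    have h : ((m : ℝ) + 1) * (m + 1).centralBinom = 2 * (2 * m + 1) * m.centralBinom := by
      exact_mod_cast Nat.succ_mul_centralBinom_succ m
    have hm : (0 : ℝ) < (m : ℝ) + 1 := by positivity
    refine le_of_mul_le_mul_left ?_ (pow_pos hm 2)
    have e : ((m : ℝ) + 1) ^ 2 * (((m + 1).centralBinom : ℝ) ^ 2 * (2 * ((m + 1 : ℕ) : ℝ) + 1))
        = 4 * ((2 * m + 1) * (2 * m + 3)) * ((m.centralBinom : ℝ) ^ 2 * (2 * m + 1)) := by
      push_cast
      linear_combination (2 * (m : ℝ) + 3) *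
        (((m : ℝ) + 1) * (m + 1).centralBinom + 2 * (2 * m + 1) * m.centralBinom) * h
    rw [e]
    calc _ ≤ 4 * ((2 * (m : ℝ) + 1) * (2 * m + 3)) * (4 ^ m) ^ 2 := by gcongr
      _ ≤ 16 * ((m : ℝ) + 1) ^ 2 * (4 ^ m) ^ 2 := by
        refine mul_le_mul_of_nonneg_right ?_ (by positivity)
        nlinarith
      _ = _ := by ring

theorem survival_one_sq_mul_le (j : ℕ) : survival j 1 ^ 2 * (j + 1) ≤ 1 := by
  have h1 : survival j 1 = (j.choose ((j + 1) / 2) : ℝ) / 2 ^ j := by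
    simp [survival]
  rw [h1, div_pow, div_mul_eq_mul_div, div_le_one (by positivity)]
  rcases Nat.even_or_odd' j with ⟨m, rfl | rfl⟩
  · have h2 : (2 * m + 1) / 2 = m := by omega
    have := centralBinom_sq_mul_le m
    rw [Nat.centralBinom_eq_two_mul_choose] at this
    rw [h2, pow_mul]
    norm_num at this ⊢
    exact this
  · have h2 : (2 * m + 1 + 1) / 2 = m + 1 := by omega
    have h3 : ((m + 1).centralBinom : ℝ) = 2 * ((2 * m + 1).choose (m + 1) : ℝ) := by
      have e : (2 * m + 1).choose m = (2 * m + 1).choose (m + 1) :=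
        Nat.choose_symm_of_eq_add (by omega)
      rw [Nat.centralBinom_eq_two_mul_choose, mul_add, mul_one, Nat.choose_succ_succ, e]
      push_cast; ring
    have := centralBinom_sq_mul_le (m + 1)
    rw [h3] at this
    rw [h2]
    have e : ((2 : ℝ) ^ (2 * m + 1)) ^ 2 * 4 = (4 ^ (m + 1)) ^ 2 := by
      rw [pow_succ 2 (2 * m), pow_mul]; norm_num; ring
    push_cast at this ⊢
    nlinarith [sq_nonneg (((2 * m + 1).choose (m + 1) : ℝ))]

theorem survival_nonneg (j k : ℕ) : 0 ≤ survival j k :=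
  Finset.sum_nonneg fun _ _ => by positivity

/-! ### The lazy walk -/

/-- The probability that the walk on `ℕ` started at `k`, which moves with probability `p` at each
step, has not hit `0` by time `n`. -/
noncomputable def lazySurvival (p : ℝ) (n : ℕ) : ℕ → ℝ :=
  ((p • killedStep + (1 - p) • (1 : Module.End ℝ (ℕ → ℝ))) ^ n) (survival 0)

theorem lazySurvival_zero (p : ℝ) : lazySurvival p 0 = survival 0 := by simp [lazySurvival]

theorem lazySurvival_succ_zero_right (p : ℝ) (n : ℕ) :
    lazySurvival p (n + 1) 0 = (1 - p) * lazySurvival p n 0 := by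
  simp [lazySurvival, pow_succ']

theorem lazySurvival_succ_succ (p : ℝ) (n k : ℕ) :
    lazySurvival p (n + 1) (k + 1) =
      p * ((lazySurvival p n (k + 2) + lazySurvival p n k) / 2)
        + (1 - p) * lazySurvival p n (k + 1) := by
  simp [lazySurvival, pow_succ']

theorem lazySurvival_zero_right (p : ℝ) (n : ℕ) : lazySurvival p n 0 = 0 := by
  induction n with
  | zero => rw [lazySurvival_zero, survival_zero_right]
  | succ n ih => rw [lazySurvival_succ_zero_right, ih, mul_zero]

/-- Moving and holding commute, so the binomial theorem shows the lazy walk to be the simple walk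
run for a binomial number of steps. -/
theorem lazySurvival_eq_sum (p : ℝ) (n k : ℕ) :
    lazySurvival p n k =
      ∑ i ∈ Finset.range (n + 1), p ^ i * (1 - p) ^ (n - i) * n.choose i * survival i k := by
  have hc : Commute (p • killedStep) ((1 - p) • (1 : Module.End ℝ (ℕ → ℝ))) :=
    (Commute.one_right _).smul_right _
  unfold lazySurvival
  rw [hc.add_pow, LinearMap.sum_apply, Finset.sum_apply]
  refine Finset.sum_congr rfl fun i _ => ?_
  have : (p • killedStep) ^ i * ((1 - p) • (1 : Module.End ℝ (ℕ → ℝ))) ^ (n - i) *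
      ((n.choose i : ℕ) : Module.End ℝ (ℕ → ℝ)) =
      (p ^ i * (1 - p) ^ (n - i) * n.choose i) • killedStep ^ i := by
    rw [smul_pow, smul_pow, one_pow, ← nsmul_one, ← Nat.cast_smul_eq_nsmul ℝ]
    simp only [mul_smul_comm, mul_one, smul_smul]
    congr 1; ring
  rw [this, LinearMap.smul_apply, killedStep_pow_survival, Pi.smul_apply, smul_eq_mul]

theorem lazySurvival_nonneg {p : ℝ} (h0 : 0 ≤ p) (h1 : p ≤ 1) (n k : ℕ) :
    0 ≤ lazySurvival p n k := by
  rw [lazySurvival_eq_sum]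
  have : 0 ≤ 1 - p := by linarith
  exact Finset.sum_nonneg fun i _ => mul_nonneg (by positivity) (survival_nonneg i k)

theorem lazySurvival_concave {p : ℝ} (h0 : 0 ≤ p) (h1 : p ≤ 1) (n k : ℕ) :
    lazySurvival p n (k + 2) + lazySurvival p n k ≤ 2 * lazySurvival p n (k + 1) := by
  induction n generalizing k with
  | zero =>
    rw [lazySurvival_zero, survival_zero_succ, survival_zero_succ]
    cases k with
    | zero => rw [survival_zero_right]; norm_num
    | succ k => rw [survival_zero_succ]; norm_num
  | succ n ih =>
    cases k with
    -- Next to the killing point, the vanishing at `0` leaves concavity at `1` weighted by `p` and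
    -- concavity at `0` weighted by `1 - p`.
    | zero =>
      rw [lazySurvival_zero_right, lazySurvival_succ_succ, lazySurvival_succ_succ]
      have i0 := ih 0
      have i1 := ih 1
      rw [lazySurvival_zero_right] at i0 ⊢
      simp only [Nat.reduceAdd, zero_add] at i0 i1 ⊢
      nlinarith [mul_le_mul_of_nonneg_left i1 h0,
        mul_le_mul_of_nonneg_left i0 (sub_nonneg.2 h1)]
    | succ k =>
      rw [lazySurvival_succ_succ, lazySurvival_succ_succ, lazySurvival_succ_succ]
      nlinarith [mul_le_mul_of_nonneg_left (ih k) h0, mul_le_mul_of_nonneg_left (ih (k + 2)) h0,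
        mul_le_mul_of_nonneg_left (ih (k + 1)) (sub_nonneg.2 h1)]

/-- The mean of `1 / (J + 1)` for a binomial variable `J`. -/
theorem sum_binomial_div_succ_le {p : ℝ} (h0 : 0 < p) (h1 : p ≤ 1) (n : ℕ) :
    ∑ i ∈ Finset.range (n + 1), p ^ i * (1 - p) ^ (n - i) * n.choose i * (1 / ((i : ℝ) + 1)) ≤
      1 / ((n + 1) * p) := by
  have hq : 0 ≤ 1 - p := by linarith
  -- Absorption, `C(n, i) / (i + 1) = C(n + 1, i + 1) / (n + 1)`, turns the sum into the expansion
  -- for `n + 1` without its zeroth term.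
  have hs := add_pow p (1 - p) (n + 1)
  rw [add_sub_cancel, one_pow, Finset.sum_range_succ'] at hs
  rw [le_div_iff₀ (by positivity), Finset.sum_mul]
  refine le_of_le_of_eq ?_ hs.symm
  refine le_add_of_le_of_nonneg (Finset.sum_le_sum fun i _ => le_of_eq ?_) (by positivity)
  have h := Nat.add_one_mul_choose_eq n i
  have h' : ((n : ℝ) + 1) * n.choose i = (n + 1).choose (i + 1) * (i + 1) := by exact_mod_cast h
  rw [Nat.add_sub_add_right]
  have hi : (i : ℝ) + 1 ≠ 0 := by positivity
  field_simp
  linear_combination p ^ (i + 1) * (1 - p) ^ (n - i) * h'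

theorem lazySurvival_one_le {p : ℝ} (h0 : 0 < p) (h1 : p ≤ 1) {n : ℕ} (hn : 1 ≤ n) :
    lazySurvival p n 1 ≤ 1 / Real.sqrt (n * p) := by
  have hq : 0 ≤ 1 - p := by linarith
  have hn' : (0 : ℝ) < n := by exact_mod_cast hn
  have hnp : 0 < n * p := by positivity
  set t := Real.sqrt (n * p) with ht
  have ht0 : 0 < t := Real.sqrt_pos.2 hnp
  have htt : t * t = n * p := Real.mul_self_sqrt hnp.le
  -- AM-GM with parameter `t` replaces `1 / √(i + 1)` by `1 / (i + 1)`, whose binomial mean is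
  -- known; `t = √(np)` balances the two terms.
  have hsurv (i : ℕ) : survival i 1 ≤ t / 2 * (1 / ((i : ℝ) + 1)) + 1 / (2 * t) := by
    have hi : (0 : ℝ) < (i : ℝ) + 1 := by positivity
    have hs : survival i 1 ^ 2 ≤ 1 / ((i : ℝ) + 1) := by
      rw [le_div_iff₀ hi]; exact survival_one_sq_mul_le i
    calc survival i 1 ≤ t / 2 * survival i 1 ^ 2 + 1 / (2 * t) := by
          have : t / 2 * survival i 1 ^ 2 + 1 / (2 * t) - survival i 1
              = (t * survival i 1 - 1) ^ 2 / (2 * t) := by field_simp; ring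
          have h2 : 0 ≤ (t * survival i 1 - 1) ^ 2 / (2 * t) := by positivity
          linarith
      _ ≤ _ := by gcongr
  have hsum : ∑ i ∈ Finset.range (n + 1), p ^ i * (1 - p) ^ (n - i) * (n.choose i : ℝ) = 1 := by
    rw [← add_pow, add_sub_cancel, one_pow]
  calc lazySurvival p n 1
      ≤ ∑ i ∈ Finset.range (n + 1), p ^ i * (1 - p) ^ (n - i) * n.choose i *
          (t / 2 * (1 / ((i : ℝ) + 1)) + 1 / (2 * t)) := by
        rw [lazySurvival_eq_sum]
        exact Finset.sum_le_sum fun i _ => mul_le_mul_of_nonneg_left (hsurv i) (by positivity)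
    _ = t / 2 * (∑ i ∈ Finset.range (n + 1),
          p ^ i * (1 - p) ^ (n - i) * n.choose i * (1 / ((i : ℝ) + 1))) + 1 / (2 * t) := by
        simp only [mul_add]
        rw [Finset.sum_add_distrib, ← Finset.sum_mul, hsum, one_mul, Finset.mul_sum]
        congr 1
        exact Finset.sum_congr rfl fun i _ => by ring
    _ ≤ t / 2 * (1 / (t * t)) + 1 / (2 * t) := by
        gcongr
        refine (sum_binomial_div_succ_le h0 h1 n).trans ?_
        rw [htt]
        gcongr
        linarith
    _ = 1 / t := by field_simp; ring

/-! ### Concave sequences and translates of finite sets -/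

/-- Increments of a concave sequence decrease, so moving two points inward symmetrically can only
increase the sum. -/
theorem add_le_add_of_concave {g : ℕ → ℝ} (hg : ∀ k, g (k + 2) + g k ≤ 2 * g (k + 1))
    (k j : ℕ) : g (k + 2 * (j + 1)) + g k ≤ g (k + j + 2) + g (k + j) := by
  have hanti : Antitone fun k => g (k + 1) - g k :=
    antitone_nat_of_succ_le fun k => by linarith [hg k]
  induction j generalizing k with
  | zero => exact le_rfl
  | succ j ih =>
    have h1 := ih (k + 1)
    have h2 : g (k + 2 * (j + 1) + 1 + 1) - g (k + 2 * (j + 1) + 1) ≤ g (k + 1) - g k :=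
      hanti (by omega : k ≤ k + 2 * (j + 1) + 1)
    rw [show k + 2 * (j + 1 + 1) = k + 2 * (j + 1) + 1 + 1 by ring,
      show k + (j + 1) + 2 = k + 1 + j + 2 by ring, show k + (j + 1) = k + 1 + j by ring]
    rw [show k + 1 + 2 * (j + 1) = k + 2 * (j + 1) + 1 by ring] at h1
    linarith

variable {Λ : Type*} [AddCommGroup Λ]

/-- A nonempty finite set invariant under translation by `b` has at least `addOrderOf b` elements,
and `b` has finite order. -/
theorem addOrderOf_le_card_of_translate_subset {A : Finset Λ} (hA : A.Nonempty)
    {b : Λ} (h : ∀ a ∈ A, a - b ∈ A) : 0 < addOrderOf b ∧ addOrderOf b ≤ A.card := by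
  obtain ⟨a, ha⟩ := hA
  have hmem (i : ℕ) : a - i • b ∈ A := by
    induction i with
    | zero => simpa using ha
    | succ i ih =>
      have := h _ ih
      rwa [succ_nsmul, ← sub_sub]
  have hpos : 0 < addOrderOf b := by
    rw [addOrderOf_pos_iff]
    by_contra hb
    have hinj := injective_nsmul_iff_not_isOfFinAddOrder.2 hb
    exact not_injective_infinite_finite (fun i : ℕ => (⟨a - i • b, hmem i⟩ : A))
      fun i j hij => hinj (sub_right_injective (congrArg Subtype.val hij))
  refine ⟨hpos, ?_⟩
  rw [← Finset.card_range (addOrderOf b)]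
  refine Finset.card_le_card_of_injOn (fun i => a - i • b) (fun i _ => hmem i) ?_
  intro i hi j hj hij
  exact nsmul_injOn_Iio_addOrderOf (by simpa using hi) (by simpa using hj)
    (sub_right_injective hij)

/-! ### The walk on the group -/

theorem toReal_conv_apply (μ ν : PMF Λ) (hν : ν.support.Finite) (a : Λ) :
    (conv μ ν a).toReal = ∑ b ∈ hν.toFinset, (ν b).toReal * (μ (a - b)).toReal := by
  rw [conv_apply, ← (Equiv.subLeft a).tsum_eq, tsum_eq_sum (s := hν.toFinset),
    ENNReal.toReal_sum]
  · refine Finset.sum_congr rfl fun b _ => ?_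
    simp [mul_comm]
  · exact fun b _ => ENNReal.mul_ne_top (PMF.apply_ne_top _ _) (PMF.apply_ne_top _ _)
  · intro b hb
    have : ν b = 0 := by simpa [PMF.mem_support_iff] using hb
    simp [this]

theorem sum_toReal_support {α : Type*} (ν : PMF α) (hν : ν.support.Finite) :
    ∑ b ∈ hν.toFinset, (ν b).toReal = 1 := by
  rw [← ENNReal.toReal_sum fun b _ => PMF.apply_ne_top _ _,
    ← tsum_eq_sum (L := SummationFilter.unconditional α), ν.tsum_coe, ENNReal.toReal_one]
  intro b hb
  simpa [PMF.mem_support_iff] using hb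

theorem sum_toReal_le_one {α : Type*} (μ : PMF α) (A : Finset α) : ∑ a ∈ A, (μ a).toReal ≤ 1 := by
  rw [← ENNReal.toReal_sum fun b _ => PMF.apply_ne_top _ _]
  refine ENNReal.toReal_le_of_le_ofReal zero_le_one ?_
  rw [ENNReal.ofReal_one, ← μ.tsum_coe]
  exact ENNReal.sum_le_tsum A

open Classical in
theorem mass_eq_sum {α : Type*} (ν : PMF α) (hν : ν.support.Finite) (B : Set α) :
    mass ν B = ∑ b ∈ hν.toFinset with b ∈ B, (ν b).toReal := by
  unfold mass
  rw [tsum_subtype B (fun a => ν a), tsum_eq_sum (s := hν.toFinset),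
    ENNReal.toReal_sum, Finset.sum_filter]
  · refine Finset.sum_congr rfl fun b _ => ?_
    by_cases hb : b ∈ B <;> simp [hb]
  · intro b _
    by_cases hb : b ∈ B <;> simp [hb, PMF.apply_ne_top]
  · intro b hb
    have : ν b = 0 := by simpa [PMF.mem_support_iff] using hb
    by_cases hb : b ∈ B <;> simp [hb, this]

open Classical in
/-- If `b` has order larger than `A.card`, the law of a uniform choice between `A` and its
translate by `b` can be rearranged onto a larger and a smaller set. -/
theorem sum_add_sum_translate_le {f : Λ → ℝ} {g : ℕ → ℝ}
    (hg : ∀ k, g (k + 2) + g k ≤ 2 * g (k + 1))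
    (hfg : ∀ A : Finset Λ, ∑ a ∈ A, f a ≤ g A.card) {A : Finset Λ} {k : ℕ} (hk : A.card = k + 1)
    {b : Λ} (hb : ¬ (0 < addOrderOf b ∧ addOrderOf b ≤ A.card)) :
    ∑ a ∈ A, f a + ∑ a ∈ A, f (a - b) ≤ g (k + 2) + g k := by
  set A' := A.image fun a => a - b with hA'
  have hinj : Function.Injective fun a : Λ => a - b := sub_left_injective
  have hcard' : A'.card = A.card := Finset.card_image_of_injective _ hinj
  have hsum' : ∑ a ∈ A, f (a - b) = ∑ a ∈ A', f a := by
    rw [hA', Finset.sum_image fun _ _ _ _ h => hinj h]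
  have hne : A.Nonempty := by rw [← Finset.card_pos]; omega
  -- Equality would make `A` invariant under `b`, forcing the order of `b` to be at most `|A|`.
  have hlt : (A ∩ A').card < A.card := by
    refine Finset.card_lt_card (Finset.inter_subset_left.ssubset_of_ne fun h => hb ?_)
    have hsub : A ⊆ A' := Finset.inter_eq_left.1 h
    have heq : A = A' := Finset.eq_of_subset_of_card_le hsub hcard'.le
    refine addOrderOf_le_card_of_translate_subset hne fun a ha => ?_
    rw [heq]
    exact Finset.mem_image_of_mem _ ha
  have hui := Finset.card_union_add_card_inter A A'
  obtain ⟨j, hj⟩ : ∃ j, k = (A ∩ A').card + j := ⟨k - (A ∩ A').card, by omega⟩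
  have hu : (A ∪ A').card = (A ∩ A').card + 2 * (j + 1) := by omega
  have hc := add_le_add_of_concave hg (A ∩ A').card j
  rw [hsum', ← Finset.sum_union_inter]
  have h1 := hfg (A ∪ A')
  have h2 := hfg (A ∩ A')
  rw [hu] at h1
  rw [← hj] at hc
  linarith

open Classical in
/-- One step of the walk: a concave bound on the concentration function evolves by the lazy walk
on `ℕ`. -/
theorem sum_conv_le {ν μ : PMF Λ} (hν : ν.support.Finite) {β : ℝ} (hβ : 0 ≤ β)
    (h0 : β ≤ (ν 0).toReal) {r : ℕ} (hr : 1 ≤ r) (hmass : mass ν (orderAtMost Λ r) ≤ 1 - β)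
    {g : ℕ → ℝ} (hg : ∀ k, g (k + 2) + g k ≤ 2 * g (k + 1))
    (hfg : ∀ A : Finset Λ, ∑ a ∈ A, (μ a).toReal ≤ g A.card)
    {A : Finset Λ} {k : ℕ} (hk : A.card = k + 1) (hkr : A.card ≤ r) :
    ∑ a ∈ A, (conv μ ν a).toReal ≤ β * (g (k + 2) + g k) + (1 - 2 * β) * g (k + 1) := by
  -- `F b` is the slack in the bound for the translate `A - b`; the goal is that its `ν`-average is
  -- at least `β * δ`.
  set F : Λ → ℝ := fun b => g (k + 1) - ∑ a ∈ A, (μ (a - b)).toReal with hF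
  have hF0 (b : Λ) : 0 ≤ F b := by
    have hinj : Function.Injective fun a : Λ => a - b := sub_left_injective
    have := hfg (A.image fun a => a - b)
    rw [Finset.sum_image fun _ _ _ _ h => hinj h, Finset.card_image_of_injective _ hinj, hk] at this
    exact sub_nonneg.2 this
  set δ := 2 * g (k + 1) - (g (k + 2) + g k) with hδ
  have hbig {b : Λ} (hb : b ∉ orderAtMost Λ r) : δ ≤ F 0 + F b := by
    have := sum_add_sum_translate_le hg hfg hk (b := b) fun h => hb ⟨h.1, h.2.trans hkr⟩
    simp only [hF, hδ, sub_zero]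
    linarith
  set s := hν.toFinset
  set big := s.filter (· ∉ orderAtMost Λ r) with hbigdef
  have hbigmass : β ≤ ∑ b ∈ big, (ν b).toReal := by
    have h := Finset.sum_filter_add_sum_filter_not s (· ∈ orderAtMost Λ r) fun b => (ν b).toReal
    rw [sum_toReal_support, ← mass_eq_sum] at h
    linarith
  have hnotmem : (0 : Λ) ∉ big := fun h =>
    (Finset.mem_filter.1 h).2 (by simpa [orderAtMost] using hr)
  -- Either `F 0` alone covers `δ`, or every large-order `b` supplies at least the missing `δ - F
  -- 0`.
  have hzero : β * δ ≤ (ν 0).toReal * F 0 + ∑ b ∈ big, (ν b).toReal * F b := by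
    have hbignn : 0 ≤ ∑ b ∈ big, (ν b).toReal * F b :=
      Finset.sum_nonneg fun b _ => mul_nonneg ENNReal.toReal_nonneg (hF0 b)
    have hfirst : β * F 0 ≤ (ν 0).toReal * F 0 := mul_le_mul_of_nonneg_right h0 (hF0 0)
    rcases le_total δ (F 0) with h | h
    · linarith [mul_le_mul_of_nonneg_left h hβ]
    · have h2 : (∑ b ∈ big, (ν b).toReal) * (δ - F 0) ≤ ∑ b ∈ big, (ν b).toReal * F b := by
        rw [Finset.sum_mul]
        refine Finset.sum_le_sum fun b hb => mul_le_mul_of_nonneg_left ?_ ENNReal.toReal_nonneg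
        linarith [hbig (Finset.mem_filter.1 hb).2]
      have h3 := mul_le_mul_of_nonneg_right hbigmass (sub_nonneg.2 h)
      linarith
  have hins : (ν 0).toReal * F 0 + ∑ b ∈ big, (ν b).toReal * F b ≤
      ∑ b ∈ s, (ν b).toReal * F b := by
    rw [← Finset.sum_insert (f := fun b => (ν b).toReal * F b) hnotmem]
    have hout : ∑ b ∈ insert 0 big with b ∈ s, (ν b).toReal * F b =
        ∑ b ∈ insert 0 big, (ν b).toReal * F b := by
      refine Finset.sum_filter_of_ne fun b _ hb => ?_
      have : ν b ≠ 0 := fun h => hb (by simp [h])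
      simpa [s, PMF.mem_support_iff] using this
    rw [← hout]
    exact Finset.sum_le_sum_of_subset_of_nonneg (fun b hb => (Finset.mem_filter.1 hb).2)
      fun b _ _ => mul_nonneg ENNReal.toReal_nonneg (hF0 b)
  have hsum : ∑ b ∈ s, (ν b).toReal * F b =
      g (k + 1) - ∑ a ∈ A, (conv μ ν a).toReal := by
    simp only [hF, mul_sub, Finset.sum_sub_distrib, toReal_conv_apply μ ν hν]
    rw [← Finset.sum_mul, sum_toReal_support, one_mul, Finset.sum_comm]
    simp only [Finset.mul_sum, s]
  rw [hsum] at hins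
  have := hzero.trans hins
  rw [hδ] at this
  linarith

/-- Littlewood–Offord type bound: the concentration function of the walk is controlled by the
survival probability of a lazy walk on `ℕ`. -/
theorem sum_convPow_le {ν : PMF Λ} (hν : ν.support.Finite) {β : ℝ} (hβ : 0 ≤ β)
    (hβ' : β ≤ 1 / 2) (h0 : β ≤ (ν 0).toReal) {r : ℕ} (hr : 1 ≤ r)
    (hmass : mass ν (orderAtMost Λ r) ≤ 1 - β) (n : ℕ) (A : Finset Λ) :
    ∑ a ∈ A, (convPow ν n a).toReal ≤
      (A.card : ℝ) / (r + 1) + lazySurvival (2 * β) n A.card := by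
  have hp0 : 0 ≤ 2 * β := by linarith
  have hp1 : 2 * β ≤ 1 := by linarith
  induction n generalizing A with
  | zero =>
    rcases A.eq_empty_or_nonempty with rfl | hA
    · simp [lazySurvival_zero_right]
    · obtain ⟨k, hk⟩ := Nat.exists_eq_succ_of_ne_zero hA.card_pos.ne'
      rw [hk, Nat.succ_eq_add_one, lazySurvival_zero, survival_zero_succ]
      exact (sum_toReal_le_one _ A).trans (le_add_of_nonneg_left (by positivity))
  | succ n ih =>
    rcases A.eq_empty_or_nonempty with rfl | hA
    · simp [lazySurvival_zero_right]
    obtain ⟨k, hk⟩ := Nat.exists_eq_add_one_of_ne_zero hA.card_pos.ne'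
    rcases le_or_gt A.card r with hkr | hkr
    · have hstep := sum_conv_le (μ := convPow ν n) hν hβ h0 hr hmass
        (g := fun k : ℕ => (k : ℝ) / (r + 1) + lazySurvival (2 * β) n k) (fun k => by
          have := lazySurvival_concave hp0 hp1 n k
          push_cast
          linear_combination this) ih hk hkr
      refine hstep.trans (le_of_eq ?_)
      rw [hk, lazySurvival_succ_succ]
      push_cast
      ring
    · refine (sum_toReal_le_one _ A).trans ?_
      -- The slope `1 / (r + 1)` is chosen so that the linear term reaches `1` as soon as `|A| > r`,
      -- where the one-step argument no longer applies.
      have h1 : (1 : ℝ) ≤ (A.card : ℝ) / (r + 1) := by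
        rw [one_le_div (by positivity)]
        exact_mod_cast hkr
      linarith [lazySurvival_nonneg hp0 hp1 (n + 1) A.card]

/-- Non-concentration without any hypothesis on generation. -/
theorem convPow_zero_le {ν : PMF Λ} (hν : ν.support.Finite) {β : ℝ} (hβ : 0 < β)
    (hβ' : β ≤ 1 / 2) (h0 : β ≤ (ν 0).toReal) {r : ℕ} (hr : 1 ≤ r)
    (hmass : mass ν (orderAtMost Λ r) ≤ 1 - β) {n : ℕ} (hn : 1 ≤ n) :
    (convPow ν n 0).toReal ≤ 1 / (r + 1) + 1 / Real.sqrt (n * β) := by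
  have h := sum_convPow_le hν hβ.le hβ' h0 hr hmass n {0}
  simp only [Finset.sum_singleton, Finset.card_singleton, Nat.cast_one] at h
  have hn' : (0 : ℝ) < n := by exact_mod_cast hn
  refine h.trans (add_le_add le_rfl ?_)
  refine (lazySurvival_one_le (by linarith) (by linarith) hn).trans ?_
  have : 0 < Real.sqrt (n * β) := Real.sqrt_pos.2 (by positivity)
  gcongr
  linarith

theorem mass_orderAtMost_one (ν : PMF Λ) : mass ν (orderAtMost Λ 1) = (ν 0).toReal := by
  have : orderAtMost Λ 1 = {0} := by
    ext a
    rw [orderAtMost, Set.mem_ofPred_eq, Set.mem_singleton_iff, ← AddMonoid.addOrderOf_eq_one_iff]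
    omega
  rw [mass, this, tsum_singleton (0 : Λ) (fun a => ν a)]

end AbelianWalk

theorem theorem3p3 :
    ∃ C : ℝ, 0 < C ∧
      ∀ (Λ : Type*) [AddCommGroup Λ] [AddGroup.FG Λ]
        (Λ₁ : AddSubgroup Λ) (hΛ : IsCompl Λ₁ (AddCommGroup.torsion Λ))
        (ν : PMF Λ) (β : ℝ),
        ν.support.Finite →
        0 < β → β < 1 / 2 →
        β ≤ (ν 0).toReal → (ν 0).toReal ≤ 1 - β →
        AbelianWalk.TorsionGenerating ν Λ₁ hΛ →
        (∀ r : ℕ, 1 ≤ r →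
          AbelianWalk.mass ν (AbelianWalk.orderAtMost Λ r) ≤ 1 - β →
          ∀ n : ℕ, 1 ≤ n →
            (AbelianWalk.convPow ν n 0).toReal ≤
              (1 + Real.exp (-(n * β / 4))) / r + 2 * C / Real.sqrt (n * β)) ∧
        (∀ n : ℕ, 1 ≤ n →
          (AbelianWalk.convPow ν n 0).toReal ≤
            (1 + Real.exp (-(n * β / 4))) / 2 + 2 * C / Real.sqrt (n * β)) := by
  refine ⟨1 / 2, by norm_num, ?_⟩
  intro Λ _ _ Λ₁ hΛ ν β hν hβ hβ' h0 h1 _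
  rw [mul_one_div_cancel two_ne_zero]
  refine ⟨fun r hr hmass n hn => ?_, fun n hn => ?_⟩
  · refine (AbelianWalk.convPow_zero_le hν hβ hβ'.le h0 hr hmass hn).trans ?_
    have hr' : (0 : ℝ) < r := by exact_mod_cast hr
    gcongr
    · linarith [Real.exp_pos (-(n * β / 4))]
    · linarith
  · have hmass := (AbelianWalk.mass_orderAtMost_one ν).trans_le h1
    refine (AbelianWalk.convPow_zero_le hν hβ hβ'.le h0 le_rfl hmass hn).trans ?_
    have : ((1 : ℕ) : ℝ) + 1 = 2 := by norm_num
    rw [this]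
    gcongr
    linarith [Real.exp_pos (-(n * β / 4))]
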